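/- Let $\Theta$ be a variety of groups and, for a finite set $X$, let $W(X)$ be the free group of $\Theta$ over $X$. For $G\in\Theta$ and $T\subseteq W(X)$ put $T''_G=\bigcap\{\ker\mu \mid \mu\in\mathrm{Hom}(W(X),G),\ T\subseteq\ker\mu\}$. Groups $G_1,G_2\in\Theta$ are geometrically equivalent, $G_1\sim G_2$, if $T''_{G_1}=T''_{G_2}$ for every finite set $X$ and every $T\subseteq W(X)$. A Mal'tsev completion $\sqrt G$ of a torsion-free nilpotent group $G$ is a nilpotent group containing $G$ in which every element has a unique $n$-th root for every $n\ge 1$, and which is minimal: no proper subgroup contains $G$ and has all roots of its elements. For even $k$ let $N(k,1)$ be the group on $\mathbb{Q}^k\times\mathbb{Q}$ with product $(v,w)(v',w')=(v+v',\,w+w'+\tfrac12 S(v,v'))$, where $S$ is the alternating form with $S(e_{2i-1},e_{2i})=1=-S(e_{2i},e_{2i-1})$ for $1\le i\le k/2$ and $S(e_i,e_j)=0$ for all other pairs of basis vectors. 1. Every finitely generated torsion-free nilpotent group of class $2$ with cyclic centre has a Mal'tsev completion of the form $N(k,1)$ with $k\geq 2$ even. 2. Let $G_1,G_2\in\Theta$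 be finitely generated torsion-free nilpotent groups of class $2$ whose centres are cyclic, and let $\sqrt{G_1}$, $\sqrt{G_2}$ be Mal'tsev completions of them. Then $G_1\sim G_2$ (with respect to $\Theta$) if and only if $\sqrt{G_1}\cong\sqrt{G_2}$. 3. Equivalently, the groups $N(k,1)$ for different even $k$ are pairwise non-equivalent: if $k\ne l$ are even and $N(k,1),N(l,1)\in\Theta$, then $N(k,1)\not\sim N(l,1)$ with respect to $\Theta$. -/

import Mathlib

/-- The variety of groups defined by the set of laws `Θ` (a law is a word in countably many
letters): `G` belongs to it when every substitution of elements of `G` for the letters sends every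
law to `1`. -/
def InVariety (Θ : Set (FreeGroup ℕ)) (G : Type*) [Group G] : Prop :=
  ∀ r ∈ Θ, ∀ φ : FreeGroup ℕ →* G, φ r = 1

/-- The verbal subgroup of the free group on `X` determined by the laws `Θ`. -/
def verbalSubgroup (Θ : Set (FreeGroup ℕ)) (X : Type*) : Subgroup (FreeGroup X) :=
  Subgroup.normalClosure {x | ∃ r ∈ Θ, ∃ φ : FreeGroup ℕ →* FreeGroup X, φ r = x}

instance verbalSubgroup_normal (Θ : Set (FreeGroup ℕ)) (X : Type*) :
    (verbalSubgroup Θ X).Normal :=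
  Subgroup.normalClosure_normal

/-- `W(X)`: the free group over `X` of the variety with laws `Θ`. -/
abbrev RelFreeGroup (Θ : Set (FreeGroup ℕ)) (X : Type*) : Type _ :=
  FreeGroup X ⧸ verbalSubgroup Θ X

/-- The algebraic variety `T'_G`: all homomorphisms `μ : W → G` with `T ⊆ ker μ`. -/
def algVariety {W : Type*} [Group W] (G : Type*) [Group G] (T : Set W) : Set (W →* G) :=
  {μ | T ⊆ (μ.ker : Set W)}

/-- The `G`-closure `T''_G` of `T`: the intersection of the kernels of the elements of `T'_G`. -/
def algClosure {W : Type*} [Group W] (G : Type*) [Group G] (T : Set W) : Subgroup W :=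
  ⨅ μ ∈ algVariety G T, μ.ker

/-- Geometric equivalence of two groups of the variety with laws `Θ`: for every finite `X`, all
subsets of `W(X)` have the same closure with respect to both groups. -/
def GeomEquiv (Θ : Set (FreeGroup ℕ)) (G₁ G₂ : Type*) [Group G₁] [Group G₂] : Prop :=
  ∀ (X : Type) [Finite X] (T : Set (RelFreeGroup Θ X)), algClosure G₁ T = algClosure G₂ T

/-- `ι : G → C` exhibits the nilpotent group `C` as a Mal'tsev completion of `G`: `ι` is injective,
every element of `C` has a unique `n`-th root for each `n ≥ 1`, and `C` is minimal, that is, no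
proper subgroup of `C` contains the image of `G` and has all roots of its elements. -/
structure IsMaltsevCompletion {G C : Type*} [Group G] [Group C] (ι : G →* C) : Prop where
  nilpotent : Group.IsNilpotent C
  injective : Function.Injective ι
  existsUnique_root : ∀ n : ℕ, n ≠ 0 → ∀ x : C, ∃! y : C, y ^ n = x
  minimal : ∀ H : Subgroup C, ι.range ≤ H →
    (∀ n : ℕ, n ≠ 0 → ∀ x ∈ H, ∃ y ∈ H, y ^ n = x) → H = ⊤

/-- Finitely generated torsion-free nilpotent groups of class exactly `2` with cyclic centre. -/
structure IsFGTorsionFreeClassTwoCyclicCenter (G : Type*) [Group G] : Prop where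
  fg : Group.FG G
  torsionFree : ∀ (g : G) (n : ℕ), n ≠ 0 → g ^ n = 1 → g = 1
  nilpotent : Group.IsNilpotent G
  class_eq_two : Group.nilpotencyClass G = 2
  cyclic_center : IsCyclic (Subgroup.center G)

/-- The matrix of the standard alternating form on `ℚ^k` (for even `k`). With basis
`e_0, …, e_{k-1}`: the value on `(e_{2i}, e_{2i+1})` is `1`, on `(e_{2i+1}, e_{2i})` it is `-1`,
and it is `0` on all other pairs of basis vectors. -/
def sympMatrix (k : ℕ) : Matrix (Fin k) (Fin k) ℚ :=
  Matrix.of fun i j =>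
    if Even i.val ∧ j.val = i.val + 1 then 1
    else if Even j.val ∧ i.val = j.val + 1 then -1
    else 0

/-- The standard alternating form `S` on `ℚ^k`. -/
def sympForm (k : ℕ) (v w : Fin k → ℚ) : ℚ :=
  ∑ i, ∑ j, sympMatrix k i j * v i * w j

/-- The underlying set `V × W`, with `V = ℚ^k` and `W = ℚ`, of the group `N(k,1)`. -/
@[ext]
structure NGroup (k : ℕ) where
  /-- the component in `V = ℚ^k` -/
  v : Fin k → ℚ
  /-- the component in `W = ℚ` -/
  w : ℚ

theorem sympForm_add_left (k : ℕ) (a b c : Fin k → ℚ) :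
    sympForm k (a + b) c = sympForm k a c + sympForm k b c := by
  simp only [sympForm, Pi.add_apply, ← Finset.sum_add_distrib]
  exact Finset.sum_congr rfl fun i _ => Finset.sum_congr rfl fun j _ => by ring

theorem sympForm_add_right (k : ℕ) (a b c : Fin k → ℚ) :
    sympForm k a (b + c) = sympForm k a b + sympForm k a c := by
  simp only [sympForm, Pi.add_apply, ← Finset.sum_add_distrib]
  exact Finset.sum_congr rfl fun i _ => Finset.sum_congr rfl fun j _ => by ring

theorem sympForm_swap (k : ℕ) (a b : Fin k → ℚ) : sympForm k a b = - sympForm k b a := by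
  simp only [sympForm, ← Finset.sum_neg_distrib]
  rw [Finset.sum_comm]
  refine Finset.sum_congr rfl fun i _ => Finset.sum_congr rfl fun j _ => ?_
  have h : sympMatrix k j i = - sympMatrix k i j := by
    simp only [sympMatrix, Matrix.of_apply]
    split_ifs <;> first | omega | simp
  rw [h]; ring

instance NGroup.instMul (k : ℕ) : Mul (NGroup k) :=
  ⟨fun x y => ⟨x.v + y.v, x.w + y.w + sympForm k x.v y.v / 2⟩⟩

instance NGroup.instOne (k : ℕ) : One (NGroup k) := ⟨⟨0, 0⟩⟩

instance NGroup.instInv (k : ℕ) : Inv (NGroup k) := ⟨fun x => ⟨-x.v, -x.w⟩⟩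

/-- The group `N(k,1)`: the nilpotent group on `V × W` whose product is
`(v, w) (v', w') = (v + v', w + w' + S(v, v') / 2)`, so that `[(v, w), (v', w')] = (0, S(v, v'))`. -/
instance NGroup.instGroup (k : ℕ) : Group (NGroup k) :=
  Group.ofLeftAxioms
    (fun a b c => by
      refine NGroup.ext (add_assoc _ _ _) ?_
      change a.w + b.w + sympForm k a.v b.v / 2 + c.w + sympForm k (a.v + b.v) c.v / 2
        = a.w + (b.w + c.w + sympForm k b.v c.v / 2) + sympForm k a.v (b.v + c.v) / 2
      rw [sympForm_add_left, sympForm_add_right]; ring)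
    (fun a => by
      refine NGroup.ext (zero_add _) ?_
      change 0 + a.w + sympForm k 0 a.v / 2 = a.w
      simp [sympForm])
    (fun a => by
      refine NGroup.ext (neg_add_cancel _) ?_
      change -a.w + a.w + sympForm k (-a.v) a.v / 2 = 0
      have h := sympForm_swap k a.v a.v
      have h' := sympForm_add_left k a.v (-a.v) a.v
      have h0 : sympForm k 0 a.v = 0 := by simp [sympForm]
      rw [add_neg_cancel, h0] at h'
      linarith)

/-! The groups $N(k,1)$ serve as normal forms. The dilations $(v,w)\mapsto(cv,c^2w)$, $c\neq0$, are
injective endomorphisms of $N(k,1)$, and if $N(k,1)$ completes $G$, a suitable one carries any given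
finite set into $G$. Hence every homomorphism from $W(X)$, $X$ finite, to $N(k,1)$ can be replaced
by one into $G$ with the same kernel. So $G\sim N(k,1)$, and likewise $N(k,1)$ satisfies the laws of
$G$.

To separate $N(k,1)$ from $N(l,1)$, map the generators of $W(X)$, $|X|=l$, to the basis vectors and
let $T$ be the kernel. Modulo $T$ each $[x_i,x_j]$ is the power $S(e_i,e_j)$ of one commutator,
which is not in $T$. Equivalence yields a homomorphism to $N(k,1)$ preserving all this, that is, $l$
vectors of $\mathbb{Q}^k$ whose Gram matrix is a nonzero multiple of the nondegenerate matrix of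
$S$. Hence $l\le k$, and $k=l$ by symmetry (`GeomEquiv.le_of_even`).

For existence, the commutator form with values in $Z(G)\cong\mathbb{Z}$, tensored with $\mathbb{Q}$
and reduced modulo its radical, gives the $v$-coordinate of an embedding; divisibility of
$\mathbb{Q}$ gives the $w$-coordinate (`exists_quadratic_splitting`). Two completions of $G$ are
isomorphic because the isolator of the diagonal copy of $G$ in their product is the graph of an
isomorphism. -/

open scoped commutatorElement

/-! ### Commutator calculus and isolators in class at most two -/

section ClassTwo

variable {C : Type*} [Group C]

theorem commutatorElement_mul_left_of_mem_center (h : ∀ x y : C, ⁅x, y⁆ ∈ Subgroup.center C)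
    (x x' y : C) : ⁅x * x', y⁆ = ⁅x, y⁆ * ⁅x', y⁆ := by
  have h1 : ⁅x * x', y⁆ = (x * ⁅x', y⁆) * x⁻¹ * ⁅x, y⁆ := by
    simp only [commutatorElement_def]; group
  rw [h1, Subgroup.mem_center_iff.1 (h x' y) x, mul_inv_cancel_right,
    Subgroup.mem_center_iff.1 (h x y)]

theorem commutatorElement_mul_right_of_mem_center (h : ∀ x y : C, ⁅x, y⁆ ∈ Subgroup.center C)
    (x y y' : C) : ⁅x, y * y'⁆ = ⁅x, y⁆ * ⁅x, y'⁆ := by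
  rw [← commutatorElement_inv, commutatorElement_mul_left_of_mem_center h, mul_inv_rev,
    commutatorElement_inv, commutatorElement_inv, Subgroup.mem_center_iff.1 (h x y)]

theorem commutatorElement_pow_left_of_mem_center (h : ∀ x y : C, ⁅x, y⁆ ∈ Subgroup.center C)
    (x y : C) (n : ℕ) : ⁅x ^ n, y⁆ = ⁅x, y⁆ ^ n := by
  induction n with
  | zero => simp
  | succ n ih => rw [pow_succ, commutatorElement_mul_left_of_mem_center h, ih, pow_succ]

theorem commutatorElement_pow_right_of_mem_center (h : ∀ x y : C, ⁅x, y⁆ ∈ Subgroup.center C)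
    (x y : C) (n : ℕ) : ⁅x, y ^ n⁆ = ⁅x, y⁆ ^ n := by
  rw [← commutatorElement_inv, commutatorElement_pow_left_of_mem_center h, ← inv_pow,
    commutatorElement_inv]

theorem mul_pow_eq_of_commutatorElement_mem_center (h : ∀ x y : C, ⁅x, y⁆ ∈ Subgroup.center C)
    (x y : C) (n : ℕ) : (x * y) ^ n = x ^ n * y ^ n * ⁅y, x⁆ ^ n.choose 2 := by
  induction n with
  | zero => simp
  | succ n ih =>
    have hc : ∀ m (g : C), g * ⁅y, x⁆ ^ m = ⁅y, x⁆ ^ m * g := fun m =>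
      Subgroup.mem_center_iff.1 (Subgroup.pow_mem _ (h y x) m)
    have h1 : y ^ n * x = x * y ^ n * ⁅y, x⁆ ^ n := by
      rw [hc, ← commutatorElement_pow_left_of_mem_center h, commutatorElement_def]; group
    rw [pow_succ (x * y), ih, mul_assoc (x ^ n * y ^ n), ← hc, mul_assoc (x ^ n), ← mul_assoc (y ^ n),
      ← mul_assoc (y ^ n), h1, Nat.choose_succ_succ' n 1, Nat.choose_one_right, pow_add ⁅y, x⁆, pow_succ x n,
      pow_succ y n, mul_assoc (x * y ^ n), ← hc]
    simp only [mul_assoc]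

/-- The isolator of a subgroup `D` of a group with central commutators: the subgroup of all
elements with a positive power in `D`. -/
def isolator (h : ∀ x y : C, ⁅x, y⁆ ∈ Subgroup.center C) (D : Subgroup C) : Subgroup C where
  carrier := {x | ∃ n : ℕ, n ≠ 0 ∧ x ^ n ∈ D}
  one_mem' := ⟨1, one_ne_zero, by simp⟩
  inv_mem' := by
    rintro x ⟨n, hn, hx⟩
    exact ⟨n, hn, by rw [inv_pow]; exact D.inv_mem hx⟩
  mul_mem' := by
    rintro x y ⟨n, hn, hx⟩ ⟨m, hm, hy⟩
    -- The factor 2 makes `choose 2` of the exponent a multiple of `m * n`, and `⁅y, x⁆ ^ (m * n) =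
    -- ⁅y ^ m, x ^ n⁆` lies in `D`.
    refine ⟨2 * (m * n), by positivity, ?_⟩
    have hc : ⁅y, x⁆ ^ (m * n) ∈ D := by
      rw [pow_mul, ← commutatorElement_pow_left_of_mem_center h,
        ← commutatorElement_pow_right_of_mem_center h]
      exact D.mul_mem (D.mul_mem (D.mul_mem hy hx) (D.inv_mem hy)) (D.inv_mem hx)
    have h2 : (2 * (m * n)).choose 2 = m * n * (2 * (m * n) - 1) := by
      rw [Nat.choose_two_right, mul_assoc, Nat.mul_div_cancel_left _ two_pos]
    rw [mul_pow_eq_of_commutatorElement_mem_center h, h2, pow_mul ⁅y, x⁆]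
    refine D.mul_mem (D.mul_mem ?_ ?_) (D.pow_mem hc _)
    · rw [show 2 * (m * n) = n * (2 * m) by ring, pow_mul]
      exact D.pow_mem hx _
    · rw [show 2 * (m * n) = m * (2 * n) by ring, pow_mul]
      exact D.pow_mem hy _

end ClassTwo

/-! ### Mal'tsev completions: centrality and uniqueness -/

namespace IsMaltsevCompletion

variable {G C : Type*} [Group G] [Group C] {ι : G →* C}

theorem pow_injective (h : IsMaltsevCompletion ι) {n : ℕ} (hn : n ≠ 0) {x y : C}
    (hxy : x ^ n = y ^ n) : x = y :=
  (h.existsUnique_root n hn (y ^ n)).unique hxy rfl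

theorem commute_of_pow (h : IsMaltsevCompletion ι) {n : ℕ} (hn : n ≠ 0) {x y : C}
    (hxy : y * x ^ n = x ^ n * y) : y * x = x * y := by
  have : (y * x * y⁻¹) ^ n = x ^ n := by rw [conj_pow, hxy, mul_inv_cancel_right]
  have := h.pow_injective hn this
  rw [mul_inv_eq_iff_eq_mul] at this
  exact this

/-- Minimality in its working form: roots exist in `C`, so a root-closed subgroup has roots of its
elements. -/
theorem eq_top_of_pow_mem (h : IsMaltsevCompletion ι) (H : Subgroup C) (hG : ι.range ≤ H)
    (hH : ∀ n : ℕ, n ≠ 0 → ∀ y : C, y ^ n ∈ H → y ∈ H) : H = ⊤ := by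
  refine h.minimal H hG fun n hn x hx => ?_
  obtain ⟨y, rfl, -⟩ := h.existsUnique_root n hn x
  exact ⟨y, hH n hn y hx, rfl⟩

/-- Unique roots make centralizers root-closed, so a centralizer containing the image of `G` is
everything. -/
theorem map_mem_center (h : IsMaltsevCompletion ι) {z : G} (hz : z ∈ Subgroup.center G) :
    ι z ∈ Subgroup.center C := by
  have := h.eq_top_of_pow_mem (Subgroup.centralizer {ι z}) ?_ ?_
  · rw [Subgroup.mem_center_iff]
    intro g
    exact ((Subgroup.mem_centralizer_singleton_iff).1 (this ▸ Subgroup.mem_top g))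
  · rintro _ ⟨g, rfl⟩
    rw [Subgroup.mem_centralizer_singleton_iff, ← map_mul, ← map_mul,
      Subgroup.mem_center_iff.1 hz g]
  · intro n hn y hy
    rw [Subgroup.mem_centralizer_singleton_iff] at hy ⊢
    exact (h.commute_of_pow hn hy.symm).symm

theorem mem_center_of_pow (h : IsMaltsevCompletion ι) {n : ℕ} (hn : n ≠ 0) {x : C}
    (hx : x ^ n ∈ Subgroup.center C) : x ∈ Subgroup.center C :=
  Subgroup.mem_center_iff.2 fun g => h.commute_of_pow hn (Subgroup.mem_center_iff.1 hx g)

/-- Roots are unique modulo the centre. -/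
theorem commutator_pow_mem_center (h : IsMaltsevCompletion ι) {n : ℕ} (hn : n ≠ 0) {x y : C}
    (hxy : ⁅y, x ^ n⁆ ∈ Subgroup.center C) : ⁅y, x⁆ ∈ Subgroup.center C := by
  obtain ⟨t, ht, -⟩ := h.existsUnique_root n hn ⁅y, x ^ n⁆
  have htc : t ∈ Subgroup.center C := h.mem_center_of_pow hn (ht ▸ hxy)
  -- As `t` is central, both bases are roots of the same element, hence equal.
  have h1 : (y * x * y⁻¹) ^ n = (t * x) ^ n := by
    have : Commute t x := (Subgroup.mem_center_iff.1 htc x).symm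
    rw [conj_pow, this.mul_pow, ht, commutatorElement_def]; group
  have h2 := h.pow_injective hn h1
  have : ⁅y, x⁆ = t := by rw [commutatorElement_def, h2, mul_inv_cancel_right]
  rwa [this]

/-- The centralizer argument modulo the centre, applied twice: first with an element of `G` in one
slot, then with an arbitrary element of `C`. -/
theorem commutator_mem_center (h : IsMaltsevCompletion ι)
    (hG : ∀ x y : G, ⁅x, y⁆ ∈ Subgroup.center G) (x y : C) : ⁅x, y⁆ ∈ Subgroup.center C := by
  have key : ∀ a : C, (∀ g, ⁅a, ι g⁆ ∈ Subgroup.center C) → ∀ y, ⁅a, y⁆ ∈ Subgroup.center C := by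
    intro a ha
    let π := QuotientGroup.mk' (Subgroup.center C)
    have hmem : ∀ y, y ∈ (Subgroup.centralizer {π a}).comap π ↔ ⁅a, y⁆ ∈ Subgroup.center C := by
      intro y
      rw [Subgroup.mem_comap, Subgroup.mem_centralizer_singleton_iff,
        ← QuotientGroup.eq_one_iff]
      change _ ↔ π ⁅a, y⁆ = 1
      rw [map_commutatorElement, commutatorElement_eq_one_iff_mul_comm]
      exact eq_comm
    have := h.eq_top_of_pow_mem ((Subgroup.centralizer {π a}).comap π) ?_ ?_
    · intro y
      rw [← hmem, this]
      trivial
    · rintro _ ⟨g, rfl⟩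
      rw [hmem]
      exact ha g
    · intro n hn y hy
      rw [hmem] at hy ⊢
      exact h.commutator_pow_mem_center hn hy
  refine key x (fun g => ?_) y
  rw [← commutatorElement_inv]
  refine Subgroup.inv_mem _ (key (ι g) (fun g' => ?_) x)
  rw [← map_commutatorElement]
  exact h.map_mem_center (hG g g')

theorem exists_pow_mem_range (h : IsMaltsevCompletion ι)
    (hC : ∀ x y : C, ⁅x, y⁆ ∈ Subgroup.center C) (x : C) : ∃ n : ℕ, n ≠ 0 ∧ x ^ n ∈ ι.range := by
  have : isolator hC ι.range = ⊤ := by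
    refine h.eq_top_of_pow_mem _ (fun x hx => ⟨1, one_ne_zero, by simpa using hx⟩) ?_
    rintro n hn y ⟨m, hm, hy⟩
    exact ⟨n * m, mul_ne_zero hn hm, by rwa [pow_mul]⟩
  exact (this ▸ Subgroup.mem_top x : x ∈ isolator hC ι.range)

/-- Mal'tsev completions of a group of class at most two are unique up to isomorphism. -/
theorem nonempty_mulEquiv {C' : Type*} [Group C'] {ι' : G →* C'} (h : IsMaltsevCompletion ι)
    (h' : IsMaltsevCompletion ι') (hG : ∀ x y : G, ⁅x, y⁆ ∈ Subgroup.center G) :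
    Nonempty (C ≃* C') := by
  have hC := h.commutator_mem_center hG
  have hC' := h'.commutator_mem_center hG
  have hP : ∀ x y : C × C', ⁅x, y⁆ ∈ Subgroup.center (C × C') := by
    intro x y
    rw [Subgroup.mem_center_iff]
    intro g
    exact Prod.ext (Subgroup.mem_center_iff.1 (hC x.1 y.1) g.1)
      (Subgroup.mem_center_iff.1 (hC' x.2 y.2) g.2)
  -- Existence of roots makes both projections of `Γ` surjective; uniqueness of roots makes them
  -- injective.
  let Γ := isolator hP (ι.prod ι').range
  have hinj : ∀ x : C × C', x ∈ Γ → (x.1 = 1 ↔ x.2 = 1) := by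
    rintro ⟨x, y⟩ ⟨n, hn, g, hg⟩
    obtain ⟨hx, hy⟩ : ι g = x ^ n ∧ ι' g = y ^ n := Prod.ext_iff.1 hg
    change x = 1 ↔ y = 1
    constructor
    · rintro rfl
      rw [one_pow, map_eq_one_iff _ h.injective] at hx
      subst hx
      refine h'.pow_injective hn ?_
      rw [← hy, map_one, one_pow]
    · rintro rfl
      rw [one_pow, map_eq_one_iff _ h'.injective] at hy
      subst hy
      refine h.pow_injective hn ?_
      rw [← hx, map_one, one_pow]
  have hsurj : ∀ (x : C), ∃ y, (x, y) ∈ Γ := by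
    intro x
    obtain ⟨n, hn, g, hg⟩ := h.exists_pow_mem_range hC x
    obtain ⟨y, hy, -⟩ := h'.existsUnique_root n hn (ι' g)
    exact ⟨y, n, hn, g, Prod.ext hg hy.symm⟩
  have hsurj' : ∀ (y : C'), ∃ x, (x, y) ∈ Γ := by
    intro y
    obtain ⟨n, hn, g, hg⟩ := h'.exists_pow_mem_range hC' y
    obtain ⟨x, hx, -⟩ := h.existsUnique_root n hn (ι g)
    exact ⟨x, n, hn, g, Prod.ext hx.symm hg⟩
  let p : Γ →* C := (MonoidHom.fst C C').comp Γ.subtype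
  let p' : Γ →* C' := (MonoidHom.snd C C').comp Γ.subtype
  have hp : Function.Bijective p := by
    refine ⟨(injective_iff_map_eq_one p).2 fun x hx => ?_, fun x => ?_⟩
    · exact Subtype.ext (Prod.ext hx ((hinj x.1 x.2).1 hx))
    · obtain ⟨y, hy⟩ := hsurj x
      exact ⟨⟨_, hy⟩, rfl⟩
  have hp' : Function.Bijective p' := by
    refine ⟨(injective_iff_map_eq_one p').2 fun x hx => ?_, fun y => ?_⟩
    · exact Subtype.ext (Prod.ext ((hinj x.1 x.2).2 hx) hx)
    · obtain ⟨x, hx⟩ := hsurj' y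
      exact ⟨⟨_, hx⟩, rfl⟩
  exact ⟨(MulEquiv.ofBijective p hp).symm.trans (MulEquiv.ofBijective p' hp')⟩

end IsMaltsevCompletion

/-! ### The standard alternating form and symplectic reduction -/

/-- Splitting off the first hyperbolic plane; this drives the inductions on dimension below. -/
theorem sympForm_succ_succ (k : ℕ) (x y : Fin (k + 2) → ℚ) :
    sympForm (k + 2) x y = x 0 * y 1 - x 1 * y 0 +
      sympForm k (fun i => x i.succ.succ) (fun i => y i.succ.succ) := by
  have h : ∀ i j : Fin k, sympMatrix (k + 2) i.succ.succ j.succ.succ = sympMatrix k i j := by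
    intro i j
    simp [sympMatrix, Nat.even_add_one]
  have h0 : ∀ j : Fin k, sympMatrix (k + 2) 0 j.succ.succ = 0 := by
    intro j; simp [sympMatrix]
  have h1 : ∀ j : Fin k, sympMatrix (k + 2) 1 j.succ.succ = 0 := by
    intro j; simp [sympMatrix]
  have h0' : ∀ j : Fin k, sympMatrix (k + 2) j.succ.succ 0 = 0 := by
    intro j; simp [sympMatrix]
  have h1' : ∀ j : Fin k, sympMatrix (k + 2) j.succ.succ 1 = 0 := by
    intro j; simp [sympMatrix]
  have e00 : sympMatrix (k + 2) 0 0 = 0 := by simp [sympMatrix]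
  have e01 : sympMatrix (k + 2) 0 1 = 1 := by simp [sympMatrix]
  have e10 : sympMatrix (k + 2) 1 0 = -1 := by simp [sympMatrix]
  have e11 : sympMatrix (k + 2) 1 1 = 0 := by simp [sympMatrix]
  simp only [sympForm, Fin.sum_univ_succ, Fin.succ_zero_eq_one, h, h0, h1, h0', h1', e00, e01, e10,
    e11]
  simp
  ring

theorem sympForm_smul_left (k : ℕ) (a : ℚ) (x y : Fin k → ℚ) :
    sympForm k (a • x) y = a * sympForm k x y := by
  simp only [sympForm, Finset.mul_sum, Pi.smul_apply, smul_eq_mul]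
  exact Finset.sum_congr rfl fun i _ => Finset.sum_congr rfl fun j _ => by ring

theorem sympForm_smul_right (k : ℕ) (a : ℚ) (x y : Fin k → ℚ) :
    sympForm k x (a • y) = a * sympForm k x y := by
  rw [sympForm_swap, sympForm_smul_left, sympForm_swap k y, mul_neg, neg_neg]

theorem sympForm_self (k : ℕ) (x : Fin k → ℚ) : sympForm k x x = 0 := by
  linarith [sympForm_swap k x x]

theorem sympForm_zero_left (k : ℕ) (x : Fin k → ℚ) : sympForm k 0 x = 0 := by
  simp [sympForm]

theorem sympForm_zero_right (k : ℕ) (x : Fin k → ℚ) : sympForm k x 0 = 0 := by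
  simp [sympForm]

theorem sympForm_single (k : ℕ) (i j : Fin k) :
    sympForm k (Pi.single i 1) (Pi.single j 1) = sympMatrix k i j := by
  simp [sympForm, Pi.single_apply]

/-- The standard form on `ℚ^k`, `k` even, is nondegenerate. -/
theorem eq_zero_of_sympForm_eq_zero {k : ℕ} (hk : Even k) {x : Fin k → ℚ}
    (h : ∀ y, sympForm k x y = 0) : x = 0 := by
  obtain ⟨m, rfl⟩ := hk.two_dvd
  clear hk
  induction m with
  | zero => ext i; exact i.elim0
  | succ m ih =>
    change Fin (2 * m + 2) → ℚ at x
    change ∀ y : Fin (2 * m + 2) → ℚ, sympForm (2 * m + 2) x y = 0 at h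
    simp only [sympForm_succ_succ] at h
    have h0 : x 0 = 0 := by
      have := h (Fin.cons 0 (Fin.cons 1 0))
      simpa [Fin.cons_one, sympForm] using this
    have h1 : x 1 = 0 := by
      have := h (Fin.cons 1 (Fin.cons 0 0))
      simpa [Fin.cons_one, sympForm] using this
    have h2 : (fun i : Fin (2 * m) => x i.succ.succ) = 0 := ih fun y => by
      have := h (Fin.cons 0 (Fin.cons 0 y))
      simpa [Fin.cons_one] using this
    ext i
    refine Fin.cases h0 (fun i => ?_) i
    refine Fin.cases h1 (fun i => ?_) i
    exact congrFun h2 i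

/-- An alternating form on a finite dimensional rational vector space is the pull-back of a
standard symplectic form along a surjective linear map. -/
theorem exists_surjective_sympForm_eq {V : Type*} [AddCommGroup V] [Module ℚ V]
    [FiniteDimensional ℚ V] (B : LinearMap.BilinForm ℚ V) (hB : ∀ x, B x x = 0) :
    ∃ k, Even k ∧ ∃ p : V →ₗ[ℚ] (Fin k → ℚ), Function.Surjective p ∧
      ∀ x y, B x y = sympForm k (p x) (p y) := by
  induction hn : Module.finrank ℚ V using Nat.strong_induction_on generalizing V with
  | _ n ih =>
    by_cases h0 : ∀ x y, B x y = 0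
    · exact ⟨0, Even.zero, 0, fun x => ⟨0, Subsingleton.elim _ _⟩, fun x y => by
        simp [h0, sympForm]⟩
    push Not at h0
    obtain ⟨e, f', hef'⟩ := h0
    have hswap : ∀ x y, B y x = - B x y := fun x y => by
      have := hB (x + y)
      simp only [map_add, LinearMap.add_apply, hB] at this
      linarith
    obtain ⟨f, hef⟩ : ∃ f, B e f = 1 := ⟨(B e f')⁻¹ • f', by simp [hef']⟩
    have hfe : B f e = -1 := by rw [hswap e f, hef]
    let W : Submodule ℚ V := LinearMap.ker (B e) ⊓ LinearMap.ker (B f)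
    have hW : ∀ x, x ∈ W ↔ B e x = 0 ∧ B f x = 0 := fun x => by
      simp [W]
    have hlt : Module.finrank ℚ W < n := by
      rw [← hn]
      refine Submodule.finrank_lt fun h => ?_
      have := ((hW f).1 (h ▸ Submodule.mem_top)).1
      rw [hef] at this
      exact one_ne_zero this
    obtain ⟨k, hk, p, hp, hpB⟩ := ih _ hlt (B.domRestrict₁₂ W W) (fun x => hB x) rfl
    -- The projection onto the orthogonal complement `W` along the hyperbolic plane spanned by `e`
    -- and `f`.
    let q0 : V →ₗ[ℚ] V := LinearMap.id + (B f).smulRight e - (B e).smulRight f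
    have hq0 : ∀ x, q0 x = x + B f x • e - B e x • f := fun x => by simp [q0]
    let q : V →ₗ[ℚ] W := q0.codRestrict W fun x => by
      rw [hW, hq0]
      simp [hB, hef, hfe]
    have hq : ∀ x, (q x : V) = x + B f x • e - B e x • f := hq0
    let P : V →ₗ[ℚ] (Fin (k + 2) → ℚ) :=
      LinearMap.pi (Fin.cons (-B f) (Fin.cons (B e) fun i => (LinearMap.proj i).comp (p.comp q)))
    have hP0 : ∀ x, P x 0 = -B f x := fun x => by simp [P]
    have hP1 : ∀ x, P x 1 = B e x := fun x => by simp [P, Fin.cons_one]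
    have hP2 : ∀ x (i : Fin k), P x i.succ.succ = p (q x) i := fun x i => by simp [P]
    refine ⟨k + 2, hk.add even_two, P, fun t => ?_, fun x y => ?_⟩
    · obtain ⟨w, hw⟩ := hp fun i => t i.succ.succ
      have hw' := (hW w).1 w.2
      refine ⟨t 0 • e + t 1 • f + w, ?_⟩
      have he : B e (t 0 • e + t 1 • f + w) = t 1 := by simp [hB, hef, hw'.1]
      have hf : B f (t 0 • e + t 1 • f + w) = - t 0 := by simp [hB, hfe, hw'.2]
      have hqw : q (t 0 • e + t 1 • f + w) = w := Subtype.ext <| by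
        rw [hq, he, hf]; module
      ext i
      refine Fin.cases (by rw [hP0, hf, neg_neg]) (fun i => ?_) i
      refine Fin.cases (by rw [Fin.succ_zero_eq_one, hP1, he]) (fun i => ?_) i
      rw [hP2, hqw, hw]
    · rw [sympForm_succ_succ]
      simp only [hP0, hP1, hP2]
      rw [← hpB]
      simp only [LinearMap.domRestrict₁₂_apply, hq]
      simp only [map_add, map_sub, map_smul, LinearMap.add_apply, LinearMap.sub_apply,
        LinearMap.smul_apply, smul_eq_mul, hB, hef, hfe, hswap e x, hswap f x]
      rw [hswap x e, hswap x f]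
      ring

/-! ### Arithmetic of the groups $N(k,1)$ -/

namespace NGroup

variable {k : ℕ}

@[simp] theorem mul_v (x y : NGroup k) : (x * y).v = x.v + y.v := rfl
@[simp] theorem mul_w (x y : NGroup k) : (x * y).w = x.w + y.w + sympForm k x.v y.v / 2 := rfl
@[simp] theorem one_v : (1 : NGroup k).v = 0 := rfl
@[simp] theorem one_w : (1 : NGroup k).w = 0 := rfl
@[simp] theorem inv_v (x : NGroup k) : (x⁻¹).v = -x.v := rfl
@[simp] theorem inv_w (x : NGroup k) : (x⁻¹).w = -x.w := rfl

theorem pow_eq (x : NGroup k) (n : ℕ) : x ^ n = ⟨(n : ℚ) • x.v, n * x.w⟩ := by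
  induction n with
  | zero => ext <;> simp
  | succ n ih =>
    rw [pow_succ, ih]
    ext i
    · simp; ring
    · simp [sympForm_smul_left, sympForm_self]; ring

theorem commutatorElement_eq (x y : NGroup k) : ⁅x, y⁆ = ⟨0, sympForm k x.v y.v⟩ := by
  rw [commutatorElement_def]
  have hneg : ∀ a b : Fin k → ℚ, sympForm k a (-b) = - sympForm k a b := fun a b => by
    have := sympForm_smul_right k (-1) a b
    simpa using this
  ext i
  · simp
  · simp [sympForm_add_left, hneg, sympForm_self, sympForm_swap k y.v x.v]
    ring

theorem mem_center_of_v_eq_zero {x : NGroup k} (hx : x.v = 0) : x ∈ Subgroup.center (NGroup k) :=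
  Subgroup.mem_center_iff.2 fun g => by
    ext i
    · simp [hx]
    · simp [hx, sympForm_zero_left, sympForm_zero_right, add_comm]

theorem commutatorElement_mem_center (x y : NGroup k) : ⁅x, y⁆ ∈ Subgroup.center (NGroup k) :=
  mem_center_of_v_eq_zero (by rw [commutatorElement_eq])

theorem isNilpotent (k : ℕ) : Group.IsNilpotent (NGroup k) := by
  refine ⟨2, ?_⟩
  rw [eq_top_iff]
  intro x _
  rw [Subgroup.mem_upperCentralSeries_succ_iff]
  intro y
  rw [Subgroup.upperCentralSeries_one]
  exact commutatorElement_mem_center x y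

theorem existsUnique_root {n : ℕ} (hn : n ≠ 0) (x : NGroup k) : ∃! y : NGroup k, y ^ n = x := by
  have hn' : (n : ℚ) ≠ 0 := Nat.cast_ne_zero.2 hn
  refine ⟨⟨(n : ℚ)⁻¹ • x.v, (n : ℚ)⁻¹ * x.w⟩, ?_, ?_⟩
  · change _ ^ n = x
    rw [pow_eq]
    exact NGroup.ext (smul_inv_smul₀ hn' _) (mul_inv_cancel_left₀ hn' _)
  · rintro y rfl
    rw [pow_eq]
    exact NGroup.ext (inv_smul_smul₀ hn' _).symm (inv_mul_cancel_left₀ hn' _).symm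

/-- The endomorphism `(v, w) ↦ (c v, c² w)` of `N(k,1)`. -/
def dilation (k : ℕ) (c : ℚ) : NGroup k →* NGroup k where
  toFun x := ⟨c • x.v, c ^ 2 * x.w⟩
  map_one' := by ext <;> simp
  map_mul' x y := by
    ext i
    · simp; ring
    · simp [sympForm_smul_left, sympForm_smul_right]; ring

theorem dilation_eq_one_iff {c : ℚ} (hc : c ≠ 0) {x : NGroup k} : dilation k c x = 1 ↔ x = 1 := by
  simp [dilation, NGroup.ext_iff, hc]

/-- The projection of `N(k,1)` onto `ℚ^k`. -/
def vHom (k : ℕ) : NGroup k →* Multiplicative (Fin k → ℚ) where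
  toFun x := Multiplicative.ofAdd x.v
  map_one' := rfl
  map_mul' _ _ := rfl

end NGroup

/-! ### Closures, dilations, and transfer between $G$ and $N(k,1)$ -/

theorem GeomEquiv.symm {Θ : Set (FreeGroup ℕ)} {G₁ G₂ : Type*} [Group G₁] [Group G₂]
    (h : GeomEquiv Θ G₁ G₂) : GeomEquiv Θ G₂ G₁ := fun X _ T => (h X T).symm

theorem GeomEquiv.trans {Θ : Set (FreeGroup ℕ)} {G₁ G₂ G₃ : Type*} [Group G₁] [Group G₂]
    [Group G₃] (h : GeomEquiv Θ G₁ G₂) (h' : GeomEquiv Θ G₂ G₃) : GeomEquiv Θ G₁ G₃ :=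
  fun X _ T => (h X T).trans (h' X T)

theorem mem_algClosure {W G : Type*} [Group W] [Group G] {T : Set W} {x : W} :
    x ∈ algClosure G T ↔ ∀ μ : W →* G, (∀ t ∈ T, μ t = 1) → μ x = 1 := by
  simp [algClosure, algVariety, Subgroup.mem_iInf, MonoidHom.mem_ker, Set.subset_def]

/-- An injective homomorphism between groups gives an inclusion of closures. -/
theorem algClosure_le_of_injective {W G H : Type*} [Group W] [Group G] [Group H] {ι : G →* H}
    (hι : Function.Injective ι) (T : Set W) : algClosure H T ≤ algClosure G T := by
  intro x hx
  rw [mem_algClosure] at hx ⊢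
  intro μ hμ
  refine (map_eq_one_iff ι hι).1 (hx (ι.comp μ) fun t ht => ?_)
  rw [MonoidHom.comp_apply, hμ t ht, map_one]

theorem GeomEquiv.of_mulEquiv (Θ : Set (FreeGroup ℕ)) {G₁ G₂ : Type*} [Group G₁] [Group G₂]
    (e : G₁ ≃* G₂) : GeomEquiv Θ G₁ G₂ := fun _ _ T =>
  le_antisymm (algClosure_le_of_injective (ι := e.symm.toMonoidHom) e.symm.injective T)
    (algClosure_le_of_injective (ι := e.toMonoidHom) e.injective T)

section Completion

variable {G : Type*} [Group G] {k : ℕ} {ι : G →* NGroup k}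

/-- Allowing all multiples of `n` lets one dilation serve finitely many elements at once. -/
theorem IsMaltsevCompletion.exists_dilation_mem_range (h : IsMaltsevCompletion ι) (x : NGroup k) :
    ∃ n : ℕ, n ≠ 0 ∧ ∀ m : ℕ, n ∣ m → NGroup.dilation k m x ∈ ι.range := by
  obtain ⟨n, hn, hx⟩ := h.exists_pow_mem_range NGroup.commutatorElement_mem_center ⟨x.v, 0⟩
  obtain ⟨m, hm, hy⟩ := h.exists_pow_mem_range NGroup.commutatorElement_mem_center ⟨0, x.w⟩
  refine ⟨n * m, mul_ne_zero hn hm, ?_⟩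
  rintro _ ⟨j, rfl⟩
  -- The central coordinate scales by the square of the factor, which explains the second exponent.
  have : NGroup.dilation k ((n * m * j : ℕ) : ℚ) x
      = ((⟨x.v, 0⟩ : NGroup k) ^ n) ^ (m * j) * ((⟨0, x.w⟩ : NGroup k) ^ m) ^ (n * n * m * j * j) := by
    rw [← pow_mul, ← pow_mul, NGroup.pow_eq, NGroup.pow_eq]
    ext i
    · simp [NGroup.dilation]; left; ring
    · simp [NGroup.dilation, sympForm_zero_right]; left; ring
  rw [this]
  exact mul_mem (pow_mem hx _) (pow_mem hy _)

theorem IsMaltsevCompletion.exists_dilation_forall_mem_range (h : IsMaltsevCompletion ι)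
    {α : Type*} [Finite α] (f : α → NGroup k) :
    ∃ n : ℕ, n ≠ 0 ∧ ∀ a, NGroup.dilation k n (f a) ∈ ι.range := by
  have := Fintype.ofFinite α
  choose n hn hmem using fun a => h.exists_dilation_mem_range (f a)
  exact ⟨∏ a, n a, Finset.prod_ne_zero_iff.2 fun a _ => hn a, fun a =>
    hmem a _ (Finset.dvd_prod_of_mem n (Finset.mem_univ a))⟩

/-- Since `X` is finite, a single dilation pushes the images of all generators into `G`; being
injective, it leaves the kernel unchanged. -/
theorem IsMaltsevCompletion.geomEquiv (h : IsMaltsevCompletion ι) (Θ : Set (FreeGroup ℕ)) :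
    GeomEquiv Θ G (NGroup k) := by
  intro X _ T
  refine le_antisymm ?_ (algClosure_le_of_injective h.injective T)
  intro x hx
  rw [mem_algClosure] at hx ⊢
  intro μ hμ
  let π := QuotientGroup.mk' (verbalSubgroup Θ X)
  obtain ⟨n, hn, hmem⟩ := h.exists_dilation_forall_mem_range fun a => μ (π (FreeGroup.of a))
  have hn' : (n : ℚ) ≠ 0 := Nat.cast_ne_zero.2 hn
  let ν := (NGroup.dilation k n).comp μ
  have hν : ∀ y, ν y ∈ ι.range := by
    intro y
    obtain ⟨y, rfl⟩ := QuotientGroup.mk'_surjective _ y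
    change (ν.comp π) y ∈ _
    induction y using FreeGroup.induction_on with
    | C1 => rw [map_one]; exact one_mem _
    | of a => exact hmem a
    | inv_of a ha => rw [map_inv]; exact inv_mem ha
    | mul a b ha hb => rw [map_mul]; exact mul_mem ha hb
  let e := MonoidHom.ofInjective h.injective
  let ν' := e.symm.toMonoidHom.comp (ν.codRestrict ι.range hν)
  have hν' : ∀ y, ν' y = 1 ↔ μ y = 1 := by
    intro y
    rw [← NGroup.dilation_eq_one_iff hn']
    change e.symm _ = 1 ↔ _
    rw [map_eq_one_iff _ e.symm.injective, Subtype.ext_iff]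
    rfl
  exact (hν' x).1 (hx ν' fun t ht => (hν' t).2 (hμ t ht))

/-- A word involves finitely many letters. Laws use countably many, but only finitely many values
can be dilated into `G` together. -/
theorem FreeGroup.exists_finset_forall_eq {α : Type*} (r : FreeGroup α) :
    ∃ s : Finset α, ∀ (H : Type _) [Group H] (f g : FreeGroup α →* H),
      (∀ a ∈ s, f (FreeGroup.of a) = g (FreeGroup.of a)) → f r = g r := by
  classical
  induction r using FreeGroup.induction_on with
  | C1 => exact ⟨∅, fun H _ f g _ => by simp⟩
  | of a => exact ⟨{a}, fun H _ f g h => h a (by simp)⟩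
  | inv_of a ha =>
    obtain ⟨s, hs⟩ := ha
    exact ⟨s, fun H _ f g h => by rw [_root_.map_inv, _root_.map_inv, hs H f g h]⟩
  | mul a b ha hb =>
    obtain ⟨s, hs⟩ := ha
    obtain ⟨t, ht⟩ := hb
    refine ⟨s ∪ t, fun H _ f g h => ?_⟩
    rw [_root_.map_mul, _root_.map_mul, hs H f g fun a ha => h a (Finset.mem_union_left _ ha),
      ht H f g fun a ha => h a (Finset.mem_union_right _ ha)]

theorem IsMaltsevCompletion.inVariety (h : IsMaltsevCompletion ι) {Θ : Set (FreeGroup ℕ)}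
    (hG : InVariety Θ G) : InVariety Θ (NGroup k) := by
  classical
  intro r hr φ
  obtain ⟨s, hs⟩ := FreeGroup.exists_finset_forall_eq r
  obtain ⟨n, hn, hmem⟩ :=
    h.exists_dilation_forall_mem_range fun a : s => φ (FreeGroup.of a.1)
  choose g hg using hmem
  let ψ : FreeGroup ℕ →* G := FreeGroup.lift fun a => if ha : a ∈ s then g ⟨a, ha⟩ else 1
  rw [← NGroup.dilation_eq_one_iff (Nat.cast_ne_zero.2 hn : (n : ℚ) ≠ 0)]
  have := hs _ ((NGroup.dilation k n).comp φ) (ι.comp ψ) fun a ha => by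
    simp [ψ, ha, hg]
  rw [← MonoidHom.comp_apply, this, MonoidHom.comp_apply, hG r hr ψ, map_one]

end Completion

/-- The homomorphism from the relatively free group to a group of the variety that takes given
values on the generators. -/
theorem InVariety.exists_hom {Θ : Set (FreeGroup ℕ)} {G : Type*} [Group G] (h : InVariety Θ G)
    {X : Type*} (f : X → G) :
    ∃ μ : RelFreeGroup Θ X →* G, ∀ a, μ (QuotientGroup.mk (FreeGroup.of a)) = f a := by
  refine ⟨QuotientGroup.lift (verbalSubgroup Θ X) (FreeGroup.lift f) ?_, fun a => ?_⟩
  swap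
  · change FreeGroup.lift f (FreeGroup.of a) = f a
    simp
  intro x hx
  have : verbalSubgroup Θ X ≤ (FreeGroup.lift f).ker := by
    refine Subgroup.normalClosure_le_normal ?_
    rintro _ ⟨r, hr, φ, rfl⟩
    exact h r hr ((FreeGroup.lift f).comp φ)
  exact this hx

/-! ### Distinguishing $N(k,1)$ from $N(l,1)$ -/

theorem sympMatrix_eq_intCast (k : ℕ) (i j : Fin k) : ∃ m : ℤ, sympMatrix k i j = m := by
  simp only [sympMatrix, Matrix.of_apply]
  split_ifs
  exacts [⟨1, by simp⟩, ⟨-1, by simp⟩, ⟨0, by simp⟩]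

/-- Vectors in `ℚ^k` whose Gram matrix is a nonzero multiple of the standard symplectic matrix of
size `l` are linearly independent. -/
theorem le_of_sympForm_eq_mul_sympMatrix {k l : ℕ} (hl : Even l) (v : Fin l → Fin k → ℚ) {c : ℚ}
    (hc : c ≠ 0) (hv : ∀ i j, sympForm k (v i) (v j) = sympMatrix l i j * c) : l ≤ k := by
  have hleft : ∀ (a : Fin l → ℚ) (y), sympForm k (∑ i, a i • v i) y
      = ∑ i, a i * sympForm k (v i) y := by
    intro a y
    let f : (Fin k → ℚ) →+ ℚ := AddMonoidHom.mk' (fun x => sympForm k x y) fun x x' =>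
      sympForm_add_left k x x' y
    change f _ = _
    rw [map_sum]
    exact Finset.sum_congr rfl fun i _ => sympForm_smul_left k _ _ _
  have hli : LinearIndependent ℚ v := by
    rw [Fintype.linearIndependent_iff]
    intro a ha
    have ha0 : a = 0 := by
      refine eq_zero_of_sympForm_eq_zero hl fun y => ?_
      have h1 : ∀ j, ∑ i, sympMatrix l i j * a i = 0 := by
        intro j
        have h := hleft a (v j)
        rw [ha, sympForm_zero_left] at h
        refine mul_right_cancel₀ hc ?_
        rw [zero_mul, h, Finset.sum_mul]
        exact Finset.sum_congr rfl fun i _ => by rw [hv]; ring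
      rw [sympForm, Finset.sum_comm]
      refine Finset.sum_eq_zero fun j _ => ?_
      rw [← Finset.sum_mul, h1, zero_mul]
    exact fun i => congrFun ha0 i
  simpa using hli.fintype_card_le_finrank

theorem GeomEquiv.le_of_even {Θ : Set (FreeGroup ℕ)} {k l : ℕ} (hl : Even l)
    (hΘ : InVariety Θ (NGroup l)) (h : GeomEquiv Θ (NGroup k) (NGroup l)) : l ≤ k := by
  rcases Nat.eq_zero_or_pos l with rfl | hpos
  · exact Nat.zero_le _
  have hl2 : 1 < l := by
    obtain ⟨m, rfl⟩ := hl
    omega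
  obtain ⟨μ, hμ⟩ := hΘ.exists_hom fun i : Fin l => (⟨Pi.single i 1, 0⟩ : NGroup l)
  let x : Fin l → RelFreeGroup Θ (Fin l) := fun i => QuotientGroup.mk (FreeGroup.of i)
  let i₀ : Fin l := ⟨0, hpos⟩
  let i₁ : Fin l := ⟨1, hl2⟩
  have hμc : ∀ i j, μ ⁅x i, x j⁆ = ⟨0, sympMatrix l i j⟩ := by
    intro i j
    rw [map_commutatorElement, hμ, hμ, NGroup.commutatorElement_eq, sympForm_single]
  have h01 : sympMatrix l i₀ i₁ = 1 := by simp [sympMatrix, i₀, i₁]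
  have hzpow : ∀ (k : ℕ) (q : ℚ) (m : ℤ), (⟨0, q⟩ : NGroup k) ^ m = ⟨0, m * q⟩ := by
    intro k q m
    obtain ⟨m, rfl | rfl⟩ := m.eq_nat_or_neg
    · rw [zpow_natCast, NGroup.pow_eq]; simp
    · rw [zpow_neg, zpow_natCast, NGroup.pow_eq]; ext <;> simp
  have hnot : ⁅x i₀, x i₁⁆ ∉ algClosure (NGroup k) (μ.ker : Set (RelFreeGroup Θ (Fin l))) := by
    rw [h (Fin l) μ.ker, mem_algClosure]
    intro hc
    have := hc μ fun t ht => ht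
    rw [hμc, h01] at this
    exact one_ne_zero (congrArg NGroup.w this)
  rw [mem_algClosure] at hnot
  push Not at hnot
  obtain ⟨ν, hν, hν1⟩ := hnot
  have hνc : ∀ i j, ν ⁅x i, x j⁆ = ⟨0, sympForm k (ν (x i)).v (ν (x j)).v⟩ := fun i j => by
    rw [map_commutatorElement, NGroup.commutatorElement_eq]
  refine le_of_sympForm_eq_mul_sympMatrix hl (fun i => (ν (x i)).v)
    (c := sympForm k (ν (x i₀)).v (ν (x i₁)).v) ?_ fun i j => ?_
  · intro h0
    rw [hνc, h0] at hν1
    exact hν1 rfl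
  · obtain ⟨m, hm⟩ := sympMatrix_eq_intCast l i j
    -- The form takes integer values on basis vectors, so its proportionalities can be written as
    -- group relations; `ν` inherits them.
    have hker : ⁅x i, x j⁆ * (⁅x i₀, x i₁⁆ ^ m)⁻¹ ∈ μ.ker := by
      rw [MonoidHom.mem_ker, map_mul, map_inv, map_zpow, hμc, hμc, h01, hzpow, mul_one, hm,
        mul_inv_cancel]
    have := hν _ hker
    rw [map_mul, map_inv, map_zpow, hνc, hνc, hzpow, mul_inv_eq_one] at this
    rw [hm]
    exact congrArg NGroup.w this

theorem GeomEquiv.eq_of_even {Θ : Set (FreeGroup ℕ)} {k l : ℕ} (hk : Even k) (hl : Even l)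
    (hΘk : InVariety Θ (NGroup k)) (hΘl : InVariety Θ (NGroup l))
    (h : GeomEquiv Θ (NGroup k) (NGroup l)) : k = l :=
  le_antisymm (h.symm.le_of_even hk hΘk) (h.le_of_even hl hΘl)

/-! ### Construction of the completion -/

/-- Rational homomorphisms extend along homomorphisms of abelian groups whose kernel they kill. -/
theorem AddMonoidHom.exists_comp_eq_of_ker_le {A B : Type*} [AddCommGroup A] [AddCommGroup B]
    (f : A →+ B) (χ : A →+ ℚ) (h : ∀ a, f a = 0 → χ a = 0) : ∃ ψ : B →+ ℚ, ∀ a, ψ (f a) = χ a := by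
  let f' : A ⧸ f.ker →+ B := QuotientAddGroup.kerLift f
  let χ' : A ⧸ f.ker →+ ℚ := QuotientAddGroup.lift f.ker χ fun a ha => h a ha
  obtain ⟨ψ, hψ⟩ := (Module.Baer.of_divisible ℚ).extension_property_addMonoidHom f'
    (QuotientAddGroup.kerLift_injective f) χ'
  exact ⟨ψ, fun a => DFunLike.congr_fun hψ (QuotientAddGroup.mk a)⟩

/-- Clearing denominators in `ℚ ⊗ A`. -/
theorem exists_nsmul_eq_one_tmul {A : Type*} [AddCommGroup A] (t : TensorProduct ℤ ℚ A) :
    ∃ n : ℕ, n ≠ 0 ∧ ∃ a : A, (n : ℚ) • t = TensorProduct.tmul ℤ 1 a := by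
  induction t using TensorProduct.induction_on with
  | zero => exact ⟨1, one_ne_zero, 0, by simp⟩
  | tmul q a =>
    refine ⟨q.den, q.den_nz, q.num • a, ?_⟩
    rw [TensorProduct.smul_tmul', ← TensorProduct.smul_tmul, smul_eq_mul, Rat.den_mul_eq_num,
      zsmul_one]
  | add s t hs ht =>
    obtain ⟨n, hn, a, ha⟩ := hs
    obtain ⟨m, hm, b, hb⟩ := ht
    refine ⟨n * m, mul_ne_zero hn hm, m • a + n • b, ?_⟩
    rw [TensorProduct.tmul_add, TensorProduct.tmul_smul, TensorProduct.tmul_smul, ← ha, ← hb,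
      smul_add, Nat.cast_mul, ← Nat.cast_smul_eq_nsmul ℚ m, ← Nat.cast_smul_eq_nsmul ℚ n,
      smul_smul, smul_smul, mul_comm (m : ℚ)]

section Existence

variable {G : Type*} [Group G]

/-- The commutator form of a group with central commutators, as a form on the abelianization. -/
theorem exists_commutator_bilinForm (hG : ∀ x y : G, ⁅x, y⁆ ∈ Subgroup.center G)
    (c : Subgroup.center G →* Multiplicative ℤ) :
    ∃ β : LinearMap.BilinForm ℤ (Additive (Abelianization G)), ∀ x y : G,
      β (Additive.ofMul (Abelianization.of x)) (Additive.ofMul (Abelianization.of y))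
        = (c ⟨⁅x, y⁆, hG x y⟩).toAdd := by
  let b₀ : G → Abelianization G →* Multiplicative ℤ := fun x => Abelianization.lift <|
    MonoidHom.mk' (fun y => c ⟨⁅x, y⁆, hG x y⟩) fun y y' => by
      rw [← map_mul]
      exact congrArg c (Subtype.ext (commutatorElement_mul_right_of_mem_center hG x y y'))
  have hb₀ : ∀ x y, b₀ x (Abelianization.of y) = c ⟨⁅x, y⁆, hG x y⟩ := fun x y =>
    Abelianization.lift_apply_of _ _
  let b : Abelianization G →* Abelianization G →* Multiplicative ℤ := Abelianization.lift <|
    MonoidHom.mk' b₀ fun x x' => by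
      refine Abelianization.hom_ext _ _ (MonoidHom.ext fun y => ?_)
      change b₀ (x * x') (Abelianization.of y) =
        b₀ x (Abelianization.of y) * b₀ x' (Abelianization.of y)
      rw [hb₀, hb₀, hb₀, ← map_mul]
      exact congrArg c (Subtype.ext (commutatorElement_mul_left_of_mem_center hG x x' y))
  let β₀ : Additive (Abelianization G) →+ Additive (Abelianization G) →+ ℤ :=
    AddMonoidHom.mk' (fun x => AddMonoidHom.mk' (fun y => (b x.toMul y.toMul).toAdd)
      fun y y' => by simp) fun x x' => by ext y; simp
  refine ⟨LinearMap.mk₂ ℤ (fun x y => β₀ x y) (fun x x' y => by simp) (fun n x y => by simp)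
    (fun x y y' => by simp) (fun n x y => by simp), fun x y => ?_⟩
  change (b (Abelianization.of x) (Abelianization.of y)).toAdd = _
  rw [← hb₀]
  congr 2

/-- Symplectic reduction of the commutator form on $\mathbb{Q}\otimes G^{ab}$. Clearing denominators
turns surjectivity there into the statement that the image of `p` meets every vector up to a
positive multiple. -/
theorem exists_hom_sympForm_eq [Group.FG G] (hG : ∀ x y : G, ⁅x, y⁆ ∈ Subgroup.center G)
    (c : Subgroup.center G →* Multiplicative ℤ) :
    ∃ k, Even k ∧ ∃ p : G →* Multiplicative (Fin k → ℚ),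
      (∀ v : Fin k → ℚ, ∃ n : ℕ, n ≠ 0 ∧ ∃ g, (p g).toAdd = (n : ℚ) • v) ∧
      ∀ x y, sympForm k (p x).toAdd (p y).toAdd = ((c ⟨⁅x, y⁆, hG x y⟩).toAdd : ℚ) := by
  obtain ⟨β, hβ⟩ := exists_commutator_bilinForm hG c
  have hFG : Group.FG (Abelianization G) := QuotientGroup.fg _
  have hfin : Module.Finite ℤ (Additive (Abelianization G)) :=
    Module.Finite.iff_addGroup_fg.2 inferInstance
  have hskew : ∀ x y, β x y = - β y x := by
    intro x y
    obtain ⟨g, hg⟩ := QuotientGroup.mk_surjective x.toMul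
    obtain ⟨h, hh⟩ := QuotientGroup.mk_surjective y.toMul
    obtain rfl : Additive.ofMul (Abelianization.of g) = x := hg
    obtain rfl : Additive.ofMul (Abelianization.of h) = y := hh
    have hinv : (⟨⁅g, h⁆, hG g h⟩ : Subgroup.center G) = (⟨⁅h, g⁆, hG h g⟩)⁻¹ :=
      Subtype.ext (commutatorElement_inv h g).symm
    rw [hβ, hβ, hinv, map_inv, toAdd_inv]
  have hskew' : ∀ x y, β.baseChange ℚ x y = - β.baseChange ℚ y x := by
    intro x y
    induction x using TensorProduct.induction_on with
    | zero => simp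
    | add x x' hx hx' => simp only [map_add, LinearMap.add_apply, hx, hx', neg_add]
    | tmul q a =>
      induction y using TensorProduct.induction_on with
      | zero => simp
      | add y y' hy hy' => simp only [map_add, LinearMap.add_apply, hy, hy', neg_add]
      | tmul r b =>
        simp only [LinearMap.BilinForm.baseChange_tmul, hskew a b]
        simp [mul_comm]
  obtain ⟨k, hk, p, hp, hpβ⟩ := exists_surjective_sympForm_eq (β.baseChange ℚ)
    (fun x => by linarith [hskew' x x])
  let p' : G →* Multiplicative (Fin k → ℚ) := MonoidHom.mk' (fun g => Multiplicative.ofAdd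
    (p (TensorProduct.tmul ℤ 1 (Additive.ofMul (Abelianization.of g))))) fun g h => by
      rw [map_mul, ofMul_mul, TensorProduct.tmul_add, map_add, ofAdd_add]
  refine ⟨k, hk, p', fun v => ?_, fun x y => ?_⟩
  · obtain ⟨t, rfl⟩ := hp v
    obtain ⟨n, hn, a, ha⟩ := exists_nsmul_eq_one_tmul t
    obtain ⟨g, hg⟩ := QuotientGroup.mk_surjective a.toMul
    refine ⟨n, hn, g, ?_⟩
    rw [← map_smul, ha]
    change p (TensorProduct.tmul ℤ 1 (Additive.ofMul (Abelianization.of g))) = _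
    exact congrArg (fun a => p (TensorProduct.tmul ℤ 1 a)) hg
  · change sympForm k (p _) (p _) = _
    rw [← hpβ, LinearMap.BilinForm.baseChange_tmul, hβ]
    simp

open scoped IsMulCommutative in
/-- A central extension with commutator form `S` admits a quadratic splitting function. -/
theorem exists_quadratic_splitting (hG : ∀ x y : G, ⁅x, y⁆ ∈ Subgroup.center G)
    (c : Subgroup.center G →* Multiplicative ℤ) {k : ℕ} (p : G →* Multiplicative (Fin k → ℚ))
    (hpz : ∀ z ∈ Subgroup.center G, (p z).toAdd = 0)
    (hp : ∀ x y, sympForm k (p x).toAdd (p y).toAdd = ((c ⟨⁅x, y⁆, hG x y⟩).toAdd : ℚ)) :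
    ∃ φ : G → ℚ, (∀ z : Subgroup.center G, φ z = (c z).toAdd) ∧
      ∀ x y, φ (x * y) = φ x + φ y + sympForm k (p x).toAdd (p y).toAdd / 2 := by
  -- The fibre product of `NGroup k` and `G` over $\mathbb{Q}^k$. Both factors have the same
  -- commutator form, so commutators of `P` lie in the graph `κ` of `c`.
  let P : Subgroup (NGroup k × G) :=
    MonoidHom.eqLocus ((NGroup.vHom k).comp (MonoidHom.fst _ _)) (p.comp (MonoidHom.snd _ _))
  let κ : Subgroup.center G →* NGroup k × G :=
    MonoidHom.mk' (fun z => (⟨0, (c z).toAdd⟩, z)) fun z z' => by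
      refine Prod.ext (NGroup.ext ?_ ?_) rfl
      · simp
      · simp [sympForm_zero_left]
  let d : G → ℚ → P := fun g q => ⟨(⟨(p g).toAdd, q⟩, g), rfl⟩
  have hd : ∀ g h q r, d g q * d h r =
      d (g * h) (q + r + sympForm k (p g).toAdd (p h).toAdd / 2) := by
    intro g h q r
    refine Subtype.ext (Prod.ext (NGroup.ext ?_ rfl) rfl)
    simp [d]
  have hcomm : commutator P ≤ κ.range.comap P.subtype := by
    rw [commutator_def, Subgroup.commutator_le]
    rintro ⟨⟨x, g⟩, hx⟩ - ⟨⟨y, h⟩, hy⟩ -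
    have hx' : x.v = (p g).toAdd := congrArg Multiplicative.toAdd hx
    have hy' : y.v = (p h).toAdd := congrArg Multiplicative.toAdd hy
    refine ⟨⟨⁅g, h⁆, hG g h⟩, Prod.ext ?_ rfl⟩
    change _ = ⁅x, y⁆
    rw [NGroup.commutatorElement_eq, hx', hy', hp]
    rfl
  let f : ℚ × Additive (Subgroup.center G) →+ Additive (Abelianization P) :=
    AddMonoidHom.mk' (fun a => Additive.ofMul (Abelianization.of (d a.2.toMul a.1)))
      fun a b => by
        rw [← ofMul_mul, ← map_mul, hd, hpz _ a.2.toMul.2, sympForm_zero_left]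
        simp
  -- `χ` vanishes on the graph of `c`, hence on everything that dies in the abelianization of `P`;
  -- it therefore extends to `P`.
  let χ : ℚ × Additive (Subgroup.center G) →+ ℚ :=
    AddMonoidHom.mk' (fun a => a.1 - ((c a.2.toMul).toAdd : ℚ)) fun a b => by simp; ring
  have hker : ∀ a, f a = 0 → χ a = 0 := by
    rintro ⟨q, z⟩ h
    have h1 : d z.toMul q ∈ (Abelianization.of (G := P)).ker := h
    rw [Abelianization.ker_of] at h1
    obtain ⟨z', hz'⟩ := MonoidHom.mem_range.1 (Subgroup.mem_comap.1 (hcomm h1))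
    have h2 : z' = z.toMul := Subtype.ext (congrArg Prod.snd hz')
    have h3 : ((c z').toAdd : ℚ) = q := congrArg (fun x => x.1.w) hz'
    change q - _ = 0
    rw [← h3, h2, sub_self]
  obtain ⟨ψ, hψ⟩ := AddMonoidHom.exists_comp_eq_of_ker_le f χ hker
  let Ψ : P → ℚ := fun x => ψ (Additive.ofMul (Abelianization.of x))
  have hΨ : ∀ x y, Ψ (x * y) = Ψ x + Ψ y := fun x y => by simp [Ψ]
  have hΨz : ∀ (z : Subgroup.center G) (q : ℚ), Ψ (d z q) = q - ((c z).toAdd : ℚ) := fun z q =>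
    hψ (q, Additive.ofMul z)
  have hΨ1 : ∀ g q, Ψ (d g q) = Ψ (d g 0) + q := by
    intro g q
    have h1 : d g 0 * d 1 q = d g q := by
      rw [hd, map_one, mul_one]
      simp [sympForm_zero_right]
    rw [← h1, hΨ]
    have := hΨz 1 q
    simp only [OneMemClass.coe_one, map_one, toAdd_one, Int.cast_zero, sub_zero] at this
    rw [this]
  refine ⟨fun g => -Ψ (d g 0), fun z => by simp [hΨz], fun x y => ?_⟩
  have := hΨ (d x 0) (d y 0)
  rw [hd, hΨ1] at this
  linarith

theorem exists_isMaltsevCompletion_NGroup [Group.FG G]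
    (hG : ∀ x y : G, ⁅x, y⁆ ∈ Subgroup.center G) (c : Subgroup.center G ≃* Multiplicative ℤ) :
    ∃ k, Even k ∧ ∃ ι : G →* NGroup k, IsMaltsevCompletion ι := by
  obtain ⟨k, hk, p, hpV, hp⟩ := exists_hom_sympForm_eq hG c.toMonoidHom
  have hpz : ∀ z, (p z).toAdd = 0 ↔ z ∈ Subgroup.center G := by
    intro z
    constructor
    · intro hz
      rw [Subgroup.mem_center_iff]
      intro g
      have h := hp g z
      rw [hz, sympForm_zero_right, eq_comm, Int.cast_eq_zero] at h
      have h1 : c ⟨⁅g, z⁆, hG g z⟩ = 1 := h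
      rw [map_eq_one_iff c c.injective] at h1
      exact commutatorElement_eq_one_iff_mul_comm.1 (congrArg Subtype.val h1)
    -- `p z` is orthogonal to a positive multiple of every vector, and the form is nondegenerate.
    · intro hz
      refine eq_zero_of_sympForm_eq_zero hk fun v => ?_
      obtain ⟨n, hn, g, hg⟩ := hpV v
      have h := hp z g
      have h1 : (⟨⁅z, g⁆, hG z g⟩ : Subgroup.center G) = 1 := Subtype.ext <|
        commutatorElement_eq_one_iff_mul_comm.2 (Subgroup.mem_center_iff.1 hz g).symm
      rw [h1, map_one, hg, sympForm_smul_right] at h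
      simpa [hn] using h
  obtain ⟨φ, hφz, hφ⟩ := exists_quadratic_splitting hG c.toMonoidHom p (fun z hz => (hpz z).2 hz) hp
  let ι : G →* NGroup k := MonoidHom.mk' (fun g => ⟨(p g).toAdd, φ g⟩) fun x y =>
    NGroup.ext (by simp) (hφ x y)
  refine ⟨k, hk, ι, NGroup.isNilpotent k, ?_, fun n hn x => NGroup.existsUnique_root hn x, ?_⟩
  · rw [injective_iff_map_eq_one]
    intro g hg
    have hgz := (hpz g).1 (congrArg NGroup.v hg)
    have h1 : φ g = 0 := congrArg NGroup.w hg
    rw [hφz ⟨g, hgz⟩, Int.cast_eq_zero] at h1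
    have h2 : c ⟨g, hgz⟩ = 1 := h1
    rw [map_eq_one_iff c c.injective] at h2
    exact congrArg Subtype.val h2
  · intro H hH hroot
    have hpow : ∀ (n : ℕ), n ≠ 0 → ∀ y : NGroup k, y ^ n ∈ H → y ∈ H := by
      intro n hn y hy
      obtain ⟨y', hy', h⟩ := hroot n hn _ hy
      rwa [← (NGroup.existsUnique_root hn (y ^ n)).unique h rfl]
    rw [eq_top_iff]
    intro x _
    obtain ⟨n, hn, g, hg⟩ := hpV x.v
    have hn' : (n : ℚ) ≠ 0 := Nat.cast_ne_zero.2 hn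
    -- This root of the image of `g` has the right `v`-coordinate; the remaining central factor is a
    -- root of an element of the image of the centre.
    have h1 : (⟨x.v, φ g / n⟩ : NGroup k) ∈ H := by
      refine hpow n hn _ ?_
      rw [NGroup.pow_eq, ← hg, mul_div_cancel₀ _ hn']
      exact hH ⟨g, rfl⟩
    have h2 : ∀ q : ℚ, (⟨0, q⟩ : NGroup k) ∈ H := by
      intro q
      refine hpow q.den q.den_nz _ ?_
      rw [NGroup.pow_eq, Rat.den_mul_eq_num, smul_zero]
      let z := c.symm (Multiplicative.ofAdd q.num)
      refine hH ⟨z, NGroup.ext ((hpz z).2 z.2) ?_⟩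
      change φ z = _
      rw [hφz]
      simp [z]
    have h3 := H.mul_mem h1 (h2 (x.w - φ g / n))
    convert h3 using 1
    refine NGroup.ext ?_ ?_
    · simp
    · simp [sympForm_zero_right]

/-! ### Finitely generated torsion-free groups of class two with cyclic centre -/

namespace IsFGTorsionFreeClassTwoCyclicCenter

theorem commutatorElement_mem_center (h : IsFGTorsionFreeClassTwoCyclicCenter G) (x y : G) :
    ⁅x, y⁆ ∈ Subgroup.center G := by
  have := h.nilpotent
  have h2 : Subgroup.upperCentralSeries G 2 = ⊤ :=
    Subgroup.upperCentralSeries_eq_top_iff_nilpotencyClass_le.2 h.class_eq_two.le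
  have hx : x ∈ Subgroup.upperCentralSeries G 2 := h2 ▸ Subgroup.mem_top x
  have := Subgroup.mem_upperCentralSeries_succ_iff.1 hx y
  rwa [Subgroup.upperCentralSeries_one] at this

theorem exists_commutatorElement_ne_one (h : IsFGTorsionFreeClassTwoCyclicCenter G) :
    ∃ x y : G, ⁅x, y⁆ ≠ 1 := by
  by_contra! hab
  have := h.nilpotent
  have h1 : Subgroup.upperCentralSeries G 1 = ⊤ := by
    rw [Subgroup.upperCentralSeries_one, eq_top_iff]
    intro x _
    exact Subgroup.mem_center_iff.2 fun g => commutatorElement_eq_one_iff_mul_comm.1 (hab g x)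
  have h2 := Subgroup.upperCentralSeries_eq_top_iff_nilpotencyClass_le.1 h1
  rw [h.class_eq_two] at h2
  omega

theorem nonempty_center_mulEquiv (h : IsFGTorsionFreeClassTwoCyclicCenter G) :
    Nonempty (Subgroup.center G ≃* Multiplicative ℤ) := by
  obtain ⟨z, hz⟩ := h.cyclic_center.exists_generator
  obtain ⟨x, y, hxy⟩ := h.exists_commutatorElement_ne_one
  have hz1 : z ≠ 1 := by
    rintro rfl
    obtain ⟨n, hn⟩ := hz ⟨⁅x, y⁆, h.commutatorElement_mem_center x y⟩
    exact hxy (by simpa using (congrArg Subtype.val hn).symm)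
  have hpow : ∀ n : ℕ, n ≠ 0 → z ^ n ≠ 1 := fun n hn hzn =>
    hz1 (Subtype.ext (h.torsionFree z n hn (by simpa using congrArg Subtype.val hzn)))
  refine ⟨(MulEquiv.ofBijective (zpowersHom (Subgroup.center G) z) ⟨?_, fun w => ?_⟩).symm⟩
  · refine (injective_iff_map_eq_one _).2 fun n hn => ?_
    change z ^ n.toAdd = 1 at hn
    obtain ⟨m, hm | hm⟩ := n.toAdd.eq_nat_or_neg
    all_goals
      rw [hm] at hn
      have hm0 : m = 0 := by
        by_contra h0
        exact hpow m h0 (by simpa using hn)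
      rw [hm0] at hm
      exact Multiplicative.toAdd.injective (by simpa using hm)
  · obtain ⟨n, hn⟩ := hz w
    exact ⟨Multiplicative.ofAdd n, hn⟩

theorem exists_isMaltsevCompletion (h : IsFGTorsionFreeClassTwoCyclicCenter G) :
    ∃ k : ℕ, 0 < k ∧ Even k ∧ ∃ ι : G →* NGroup k, IsMaltsevCompletion ι := by
  have := h.fg
  obtain ⟨c⟩ := h.nonempty_center_mulEquiv
  obtain ⟨k, hk, ι, hι⟩ := exists_isMaltsevCompletion_NGroup h.commutatorElement_mem_center c
  refine ⟨k, Nat.pos_of_ne_zero ?_, hk, ι, hι⟩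
  -- $N(0,1)$ is abelian, whereas `G` has a nontrivial commutator.
  rintro rfl
  obtain ⟨x, y, hxy⟩ := h.exists_commutatorElement_ne_one
  refine hxy (hι.injective ?_)
  rw [map_commutatorElement, map_one, NGroup.commutatorElement_eq]
  exact NGroup.ext (Subsingleton.elim _ _) (by simp [sympForm])

end IsFGTorsionFreeClassTwoCyclicCenter

end Existence

theorem theorem3 :
    -- the Mal'tsev completion exists, and is a group N(k,1) with k positive and even
    (∀ (G : Type*) [Group G], IsFGTorsionFreeClassTwoCyclicCenter G →
      ∃ k : ℕ, 0 < k ∧ Even k ∧ ∃ ι : G →* NGroup k, IsMaltsevCompletion ι) ∧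
    -- G₁ ~ G₂ if and only if √G₁ ≅ √G₂
    (∀ (Θ : Set (FreeGroup ℕ)) (G₁ G₂ C₁ C₂ : Type*) [Group G₁] [Group G₂] [Group C₁] [Group C₂]
      (ι₁ : G₁ →* C₁) (ι₂ : G₂ →* C₂),
      IsFGTorsionFreeClassTwoCyclicCenter G₁ → IsFGTorsionFreeClassTwoCyclicCenter G₂ →
      InVariety Θ G₁ → InVariety Θ G₂ →
      IsMaltsevCompletion ι₁ → IsMaltsevCompletion ι₂ →
      (GeomEquiv Θ G₁ G₂ ↔ Nonempty (C₁ ≃* C₂))) ∧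
    -- the groups N(k,1) for different even k are pairwise non-equivalent
    (∀ (Θ : Set (FreeGroup ℕ)) (k l : ℕ), Even k → Even l → k ≠ l →
      InVariety Θ (NGroup k) → InVariety Θ (NGroup l) →
      ¬ GeomEquiv Θ (NGroup k) (NGroup l)) := by
  refine ⟨fun G _ h => h.exists_isMaltsevCompletion, ?_,
    fun Θ k l hk hl hne hΘk hΘl h => hne (h.eq_of_even hk hl hΘk hΘl)⟩
  intro Θ G₁ G₂ C₁ C₂ _ _ _ _ ι₁ ι₂ hG₁ hG₂ hΘ₁ hΘ₂ hι₁ hι₂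
  obtain ⟨k, -, hk, j₁, hj₁⟩ := hG₁.exists_isMaltsevCompletion
  obtain ⟨l, -, hl, j₂, hj₂⟩ := hG₂.exists_isMaltsevCompletion
  obtain ⟨e₁⟩ := hι₁.nonempty_mulEquiv hj₁ hG₁.commutatorElement_mem_center
  obtain ⟨e₂⟩ := hι₂.nonempty_mulEquiv hj₂ hG₂.commutatorElement_mem_center
  constructor
  · intro h
    have hkl : GeomEquiv Θ (NGroup k) (NGroup l) :=
      ((hj₁.geomEquiv Θ).symm.trans h).trans (hj₂.geomEquiv Θ)
    obtain rfl := hkl.eq_of_even hk hl (hj₁.inVariety hΘ₁) (hj₂.inVariety hΘ₂)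
    exact ⟨e₁.trans e₂.symm⟩
  · rintro ⟨e⟩
    exact ((hj₁.geomEquiv Θ).trans (GeomEquiv.of_mulEquiv Θ ((e₁.symm.trans e).trans e₂))).trans
      (hj₂.geomEquiv Θ).symm
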